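/- Let $\mathbb{B}=\{q\in\mathbb{H}:|q|<1\}$ be the open unit ball of the quaternions, $\mathrm{Sp}(1)=\{u\in\mathbb{H}:|u|=1\}$, and $\mathrm{Sp}(1,1)=\{A\in M_2(\mathbb{H}):A^*I_{1,1}A=I_{1,1}\}$ with $I_{1,1}=\operatorname{diag}(1,-1)$, a Lie group with its manifold structure as a closed embedded submanifold of $M_2(\mathbb{H})\cong\mathbb{R}^{16}$. Let $\mathrm{Sp}(1)\times\{1\}=\{\operatorname{diag}(u,1):u\in\mathrm{Sp}(1)\}$ and $\mathrm{Sp}(1)I_2=\{\operatorname{diag}(u,u):u\in\mathrm{Sp}(1)\}$, subgroups of $\mathrm{Sp}(1,1)$. For functions on $\mathbb{B}$ with expansions $f(q)=\sum_n q^na_n$ and $g(q)=\sum_n q^nb_n$, let $(f*g)(q)=\sum_n q^n\sum_{k=0}^n a_kb_{n-k}$, $f^c(q)=\sum_n q^n\overline{a}_n$, $f^s=f*f^c$ and $f^{-*}=\frac{1}{f^s}f^c$. For $A=\begin{pmatrix}a&c\\ b&d\end{pmatrix}\in\mathrm{Sp}(1,1)$ the regular Möbius transformation is $\mathcal{F}_A=l_{(c,d)}^{-*}*l_{(a,b)}$,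 where $l_{(a,b)}(q)=qa+b$. Theorem. Each $\mathcal{F}_A$, $A\in\mathrm{Sp}(1,1)$, is a bijection of $\mathbb{B}$ onto $\mathbb{B}$. The double coset space $$D=(\mathrm{Sp}(1)\times\{1\})\backslash\mathrm{Sp}(1,1)/\mathrm{Sp}(1)I_2,$$ with the quotient topology, is Hausdorff and second countable, and it carries a natural smooth manifold structure, of dimension $4$: there is one and only one smooth manifold structure on $D$, compatible with its topology, for which the projection $\mathrm{Sp}(1,1)\to D$ is a submersion (a surjective smooth map whose differential at every point is surjective). For this structure, the map $$D\to\mathbb{B},\qquad (\mathrm{Sp}(1)\times\{1\})\,A\,\mathrm{Sp}(1)I_2\mapsto\big(\mathcal{F}_{A^{-1}}\big)^{-1}(0),$$ is well defined and is a diffeomorphism. -/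

import Mathlib

open scoped Manifold ContDiff Quaternion Topology Matrix Matrix.Norms.Operator

noncomputable section

namespace RegMobius

/-! ### The group `Sp(1,1)` -/

/-- The `2 × 2` matrices over the quaternions. -/
abbrev M₂ : Type := Matrix (Fin 2) (Fin 2) ℍ[ℝ]

/-- The usual topology of `M₂(ℍ)`, spelled as the topology of the norm in use here, so that the
topological and the normed structures agree for instance search. -/
instance : TopologicalSpace M₂ :=
  (Matrix.linftyOpNormedRing :
    NormedRing M₂).toMetricSpace.toPseudoMetricSpace.toUniformSpace.toTopologicalSpace

lemma topology_eq : (inferInstance : TopologicalSpace M₂) = instTopologicalSpaceMatrix := rfl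

/-- The matrix `I_{1,1} = diag(1,-1)`. -/
def J : M₂ := !![1, 0; 0, -1]

lemma J_mul_J : J * J = 1 := by
  rw [J, Matrix.one_fin_two]; simp

lemma J_conjTranspose : Jᴴ = J :=
  Matrix.ext fun i j => by fin_cases i <;> fin_cases j <;> simp [J]

/-- `Sp(1,1) = {A ∈ M₂(ℍ) : A* I_{1,1} A = I_{1,1}}`, as a submonoid of `M₂(ℍ)`. -/
def Sp11 : Submonoid M₂ where
  carrier := {A | Aᴴ * J * A = J}
  one_mem' := by simp
  mul_mem' {A B} hA hB := by
    simp only [Set.mem_ofPred_eq] at *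
    rw [Matrix.conjTranspose_mul,
      show Bᴴ * Aᴴ * J * (A * B) = Bᴴ * (Aᴴ * J * A) * B by simp only [mul_assoc], hA, hB]

lemma mem_Sp11 {A : M₂} : A ∈ Sp11 ↔ Aᴴ * J * A = J := Iff.rfl

lemma inv_mul_aux {A : M₂} (hA : A ∈ Sp11) : J * Aᴴ * J * A = 1 := by
  rw [mul_assoc, mul_assoc, ← mul_assoc Aᴴ, mem_Sp11.1 hA, J_mul_J]

lemma inv_mem_aux {A : M₂} (hA : A ∈ Sp11) : J * Aᴴ * J ∈ Sp11 := by
  have h : A * (J * Aᴴ * J) = 1 := mul_eq_one_comm.1 (inv_mul_aux hA)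
  rw [mem_Sp11]
  simp only [Matrix.conjTranspose_mul, Matrix.conjTranspose_conjTranspose, J_conjTranspose]
  calc J * (A * J) * J * (J * Aᴴ * J) = J * A * (J * J) * (J * Aᴴ * J) := by
        simp only [mul_assoc]
    _ = J * (A * (J * Aᴴ * J)) := by rw [J_mul_J, mul_one, mul_assoc]
    _ = J := by rw [h, mul_one]

/-- The group structure of `Sp(1,1)`: matrix multiplication, with `A⁻¹ = I_{1,1} A* I_{1,1}`. -/
instance : Group Sp11 :=
  { (inferInstance : Monoid Sp11) with
    inv := fun A => ⟨J * (A : M₂)ᴴ * J, inv_mem_aux A.2⟩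
    inv_mul_cancel := fun A => Subtype.ext (inv_mul_aux A.2) }

lemma coe_inv_mul (A : Sp11) : ((A⁻¹ : Sp11) : M₂) * (A : M₂) = 1 := inv_mul_aux A.2

lemma coe_mul_inv (A : Sp11) : (A : M₂) * ((A⁻¹ : Sp11) : M₂) = 1 :=
  mul_eq_one_comm.1 (coe_inv_mul A)

/-! ### The manifold structure of `Sp(1,1)` -/

/-- The Lie algebra of `Sp(1,1)`, a real vector space of dimension `10`; it is the model space
of the manifold `Sp(1,1)`. -/
def sp11 : Submodule ℝ M₂ where
  carrier := {Y | Yᴴ * J + J * Y = 0}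
  zero_mem' := by simp
  add_mem' {X Y} hX hY := by
    simp only [Set.mem_ofPred_eq] at *
    rw [Matrix.conjTranspose_add, add_mul, mul_add, add_add_add_comm, hX, hY, add_zero]
  smul_mem' c X hX := by
    simp only [Set.mem_ofPred_eq] at *
    have h : (c • X)ᴴ = c • Xᴴ := Matrix.ext fun i j => by simp [Matrix.conjTranspose_apply]
    rw [h, smul_mul_assoc, mul_smul_comm, ← smul_add, hX,
      smul_zero]

lemma mem_sp11 {Y : M₂} : Y ∈ sp11 ↔ Yᴴ * J + J * Y = 0 := Iff.rfl

/-- The Cayley transform `X ↦ (1 - X)(1 + X)⁻¹` (equal to `0` where `1 + X` is not invertible). -/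
def cayley (X : M₂) : M₂ := (1 - X) * Ring.inverse (1 + X)

lemma cayley_one_add {X : M₂} (h : IsUnit (1 + X)) :
    1 + cayley X = (2 : ℝ) • Ring.inverse (1 + X) := by
  have : (1 : M₂) = (1 + X) * Ring.inverse (1 + X) := (Ring.mul_inverse_cancel _ h).symm
  calc 1 + cayley X = (1 + X) * Ring.inverse (1 + X) + (1 - X) * Ring.inverse (1 + X) := by
        rw [← this, cayley]
    _ = (2 : ℝ) • Ring.inverse (1 + X) := by rw [← add_mul, two_smul]; noncomm_ring

lemma cayley_one_sub {X : M₂} (h : IsUnit (1 + X)) :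
    1 - cayley X = (2 : ℝ) • (X * Ring.inverse (1 + X)) := by
  have : (1 : M₂) = (1 + X) * Ring.inverse (1 + X) := (Ring.mul_inverse_cancel _ h).symm
  calc 1 - cayley X = (1 + X) * Ring.inverse (1 + X) - (1 - X) * Ring.inverse (1 + X) := by
        rw [← this, cayley]
    _ = (2 : ℝ) • (X * Ring.inverse (1 + X)) := by rw [← sub_mul, two_smul]; noncomm_ring

lemma cayley_isUnit {X : M₂} (h : IsUnit (1 + X)) : IsUnit (1 + cayley X) := by
  rw [cayley_one_add h, isUnit_iff_exists]
  refine ⟨(2⁻¹ : ℝ) • (1 + X), ?_, ?_⟩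
  · rw [smul_mul_smul_comm, Ring.inverse_mul_cancel _ h]; norm_num
  · rw [smul_mul_smul_comm, Ring.mul_inverse_cancel _ h]; norm_num

lemma cayley_cayley {X : M₂} (h : IsUnit (1 + X)) : cayley (cayley X) = X := by
  have hu := cayley_isUnit h
  have key : 1 - cayley X = X * (1 + cayley X) := by
    rw [cayley_one_sub h, cayley_one_add h, mul_smul_comm]
  rw [cayley, key, mul_assoc, Ring.mul_inverse_cancel _ hu, mul_one]

lemma cayley_mem_sp11 {X : M₂} (hX : X ∈ Sp11) : cayley X ∈ sp11 := by
  by_cases h : IsUnit (1 + X)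
  · obtain ⟨u, hu⟩ := h
    have hV : Ring.inverse (1 + X) = ((u⁻¹ : M₂ˣ) : M₂) := by rw [← hu, Ring.inverse_unit]
    set V : M₂ := ((u⁻¹ : M₂ˣ) : M₂) with hVdef
    have h1 : (1 + X) * V = 1 := by rw [← hu]; exact u.mul_inv
    have h2 : V * (1 + X) = 1 := by rw [← hu]; exact u.inv_mul
    have h1' : Vᴴ * (1 + Xᴴ) = 1 := by
      simpa using congrArg Matrix.conjTranspose h1
    have comm : (1 - X) * V = V * (1 - X) := by
      have : (1 + X) * (1 - X) = (1 - X) * (1 + X) := by noncomm_ring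
      calc (1 - X) * V = V * ((1 + X) * (1 - X)) * V := by rw [← mul_assoc, h2, one_mul]
        _ = V * (1 - X) * ((1 + X) * V) := by rw [this]; simp only [mul_assoc]
        _ = V * (1 - X) := by rw [h1, mul_one]
    rw [mem_sp11, cayley, hV]
    have e : (1 - Xᴴ) * J * (1 + X) + (1 + Xᴴ) * J * (1 - X) = 0 := by
      have := mem_Sp11.1 hX
      have e' : (1 - Xᴴ) * J * (1 + X) + (1 + Xᴴ) * J * (1 - X)
          = (2 : ℝ) • (J - Xᴴ * J * X) := by rw [two_smul]; noncomm_ring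
      rw [e', this, sub_self, smul_zero]
    calc ((1 - X) * V)ᴴ * J + J * ((1 - X) * V)
        = Vᴴ * (1 - Xᴴ) * J * ((1 + X) * V) + Vᴴ * (1 + Xᴴ) * J * ((1 - X) * V) := by
          rw [h1, h1']; simp
      _ = Vᴴ * ((1 - Xᴴ) * J * (1 + X) + (1 + Xᴴ) * J * (1 - X)) * V := by noncomm_ring
      _ = 0 := by rw [e]; simp
  · rw [cayley, Ring.inverse_non_unit _ h, mul_zero]; exact zero_mem _

lemma cayley_mem_Sp11 {Y : M₂} (hY : Y ∈ sp11) (h : IsUnit (1 + Y)) : cayley Y ∈ Sp11 := by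
  have h1 := Ring.mul_inverse_cancel _ h
  set V : M₂ := Ring.inverse (1 + Y) with hVdef
  have h1' : Vᴴ * (1 + Yᴴ) = 1 := by simpa using congrArg Matrix.conjTranspose h1
  have e : (1 - Yᴴ) * J * (1 - Y) = (1 + Yᴴ) * J * (1 + Y) := by
    have e' : (1 - Yᴴ) * J * (1 - Y) - (1 + Yᴴ) * J * (1 + Y)
        = (-2 : ℝ) • (Yᴴ * J + J * Y) := by rw [neg_smul, two_smul]; noncomm_ring
    rw [mem_sp11.1 hY, smul_zero] at e'
    exact sub_eq_zero.1 e'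
  rw [mem_Sp11, cayley, ← hVdef]
  calc ((1 - Y) * V)ᴴ * J * ((1 - Y) * V) = Vᴴ * ((1 - Yᴴ) * J * (1 - Y)) * V := by
        simp [mul_assoc]
    _ = (Vᴴ * (1 + Yᴴ)) * J * ((1 + Y) * V) := by rw [e]; simp only [mul_assoc]
    _ = J := by rw [h1, h1', one_mul, mul_one]

lemma contDiffAt_cayley {X : M₂} (h : IsUnit (1 + X)) : ContDiffAt ℝ ∞ cayley X := by
  have hinv : ContDiffAt ℝ ∞ (Ring.inverse : M₂ → M₂) (1 + X) := by
    obtain ⟨u, hu⟩ := h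
    rw [← hu]; exact contDiffAt_ringInverse ℝ u
  have h2 : ContDiffAt ℝ ∞ (fun X : M₂ => 1 + X) X := contDiffAt_const.add contDiffAt_id
  exact (contDiffAt_const.sub contDiffAt_id).mul (hinv.comp X h2)

lemma isOpen_one_add : IsOpen {X : M₂ | IsUnit (1 + X)} :=
  Units.isOpen.preimage (continuous_const.add continuous_id)

/-- The inverse of the Cayley transform centred at `A₀`. -/
def cayleyInv (A₀ : Sp11) (Y : sp11) : Sp11 :=
  open Classical in
  if h : IsUnit (1 + (Y : M₂)) then A₀ * ⟨cayley Y, cayley_mem_Sp11 Y.2 h⟩ else A₀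

lemma coe_cayleyInv (A₀ : Sp11) {Y : sp11} (h : IsUnit (1 + (Y : M₂))) :
    (cayleyInv A₀ Y : M₂) = (A₀ : M₂) * cayley Y := by
  simp [cayleyInv, h]

lemma inv_mul_coe_cayleyInv (A₀ : Sp11) {Y : sp11} (h : IsUnit (1 + (Y : M₂))) :
    ((A₀⁻¹ * cayleyInv A₀ Y : Sp11) : M₂) = cayley Y := by
  rw [Submonoid.coe_mul, coe_cayleyInv A₀ h, ← mul_assoc, coe_inv_mul, one_mul]

/-- The Cayley chart of `Sp(1,1)` centred at `A₀`:
`A ↦ (1 - A₀⁻¹A)(1 + A₀⁻¹A)⁻¹`. -/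
def cayleyChart (A₀ : Sp11) : OpenPartialHomeomorph Sp11 sp11 where
  toFun A := ⟨cayley ((A₀⁻¹ * A : Sp11) : M₂), cayley_mem_sp11 (A₀⁻¹ * A).2⟩
  invFun := cayleyInv A₀
  source := {A | IsUnit (1 + ((A₀⁻¹ * A : Sp11) : M₂))}
  target := {Y | IsUnit (1 + (Y : M₂))}
  map_source' A hA := cayley_isUnit hA
  map_target' Y hY := by
    simp only [Set.mem_ofPred_eq] at hY ⊢
    rw [inv_mul_coe_cayleyInv A₀ hY]; exact cayley_isUnit hY
  left_inv' A hA := by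
    apply Subtype.ext
    rw [coe_cayleyInv A₀ (cayley_isUnit hA)]
    simp only [cayley_cayley hA]
    rw [Submonoid.coe_mul, ← mul_assoc, coe_mul_inv, one_mul]
  right_inv' Y hY := by
    apply Subtype.ext
    change cayley _ = _
    rw [inv_mul_coe_cayleyInv A₀ hY, cayley_cayley hY]
  open_source := by
    refine isOpen_one_add.preimage ?_
    change Continuous fun A : Sp11 => ((A₀⁻¹ : Sp11) : M₂) * (A : M₂)
    exact continuous_const.mul continuous_subtype_val
  open_target := isOpen_one_add.preimage continuous_subtype_val
  continuousOn_toFun := by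
    intro A hA
    refine ContinuousAt.continuousWithinAt ?_
    rw [Topology.IsInducing.subtypeVal.continuousAt_iff]
    have h1 : ContinuousAt (fun A : Sp11 => ((A₀⁻¹ : Sp11) : M₂) * (A : M₂)) A :=
      (continuous_const.mul continuous_subtype_val).continuousAt
    exact ContinuousAt.comp (f := fun A : Sp11 => ((A₀⁻¹ : Sp11) : M₂) * (A : M₂))
      (contDiffAt_cayley hA).continuousAt h1
  continuousOn_invFun := by
    intro Y hY
    have hY' : IsUnit (1 + (Y : M₂)) := hY
    refine ContinuousAt.continuousWithinAt ?_
    rw [Topology.IsInducing.subtypeVal.continuousAt_iff]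
    have h1 : ContinuousAt (fun Y : sp11 => (A₀ : M₂) * cayley Y) Y :=
      continuousAt_const.mul ((contDiffAt_cayley hY').continuousAt.comp
        continuous_subtype_val.continuousAt)
    refine h1.congr ?_
    filter_upwards [(isOpen_one_add.preimage continuous_subtype_val).mem_nhds hY'] with Z hZ
    exact (coe_cayleyInv A₀ hZ).symm

/-- A local homeomorphism `e` from `Sp(1,1)` to the model space is a chart of the embedded
submanifold `Sp(1,1) ⊆ M₂(ℍ) ≅ ℝ¹⁶` if its inverse is smooth as a map into `M₂(ℍ)`, and if it is
itself, around each point of its domain, the restriction of a smooth map defined on `M₂(ℍ)`. -/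
def IsSubmanifoldChart (e : OpenPartialHomeomorph Sp11 sp11) : Prop :=
  ContDiffOn ℝ ∞ (fun Y => ((e.symm Y : Sp11) : M₂)) e.target ∧
    ∀ A ∈ e.source, ∃ g : M₂ → sp11, ContDiffAt ℝ ∞ g (A : M₂) ∧
      ∀ᶠ B : Sp11 in 𝓝 A, g (B : M₂) = e B

lemma isSubmanifoldChart_cayleyChart (A₀ : Sp11) : IsSubmanifoldChart (cayleyChart A₀) := by
  constructor
  · intro Y hY
    have hY' : IsUnit (1 + (Y : M₂)) := hY
    have h1 : ContDiffAt ℝ ∞ (fun Y : sp11 => (A₀ : M₂) * cayley Y) Y :=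
      contDiffAt_const.mul ((contDiffAt_cayley hY').comp Y sp11.subtypeL.contDiff.contDiffAt)
    refine (h1.congr_of_eventuallyEq ?_).contDiffWithinAt
    filter_upwards [(isOpen_one_add.preimage continuous_subtype_val).mem_nhds hY'] with Z hZ
    exact coe_cayleyInv A₀ hZ
  · intro A hA
    obtain ⟨p, hp⟩ := sp11.subtype.exists_leftInverse_of_injective (Submodule.ker_subtype _)
    refine ⟨fun B => p (cayley (((A₀⁻¹ : Sp11) : M₂) * B)), ?_, Filter.Eventually.of_forall ?_⟩
    · have h1 : ContDiffAt ℝ ∞ (fun B : M₂ => ((A₀⁻¹ : Sp11) : M₂) * B) (A : M₂) :=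
        contDiffAt_const.mul contDiffAt_id
      have h2 : ContDiffAt ℝ ∞ cayley (((A₀⁻¹ : Sp11) : M₂) * (A : M₂)) := contDiffAt_cayley hA
      exact (LinearMap.toContinuousLinearMap p).contDiff.contDiffAt.comp _ (h2.comp _ h1)
    · intro B
      exact LinearMap.congr_fun hp (cayleyChart A₀ B)

/-- `Sp(1,1)` as a manifold: the atlas consists of all its charts as an embedded submanifold
of `M₂(ℍ)`. -/
instance : ChartedSpace sp11 Sp11 where
  atlas := {e | IsSubmanifoldChart e}
  chartAt := cayleyChart
  mem_chart_source A := by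
    change IsUnit (1 + ((A⁻¹ * A : Sp11) : M₂))
    rw [inv_mul_cancel, Submonoid.coe_one]
    exact isUnit_iff_exists.2 ⟨(2⁻¹ : ℝ) • 1, by
      rw [mul_smul_comm, mul_one, smul_add, ← add_smul]; norm_num, by
      rw [smul_mul_assoc, one_mul, smul_add, ← add_smul]; norm_num⟩
  chart_mem_atlas := isSubmanifoldChart_cayleyChart

instance : IsManifold 𝓘(ℝ, sp11) ∞ Sp11 := by
  refine isManifold_of_contDiffOn _ _ _ ?_
  intro e e' he he' Y hY
  simp only [modelWithCornersSelf_coe, modelWithCornersSelf_coe_symm, Function.id_comp,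
    Function.comp_id, Set.range_id, Set.inter_univ, Set.preimage_id,
    OpenPartialHomeomorph.trans_source, OpenPartialHomeomorph.symm_source] at hY ⊢
  obtain ⟨g, hg, hge⟩ := he'.2 (e.symm Y) hY.2
  have h1 : ContDiffAt ℝ ∞ (fun Y => ((e.symm Y : Sp11) : M₂)) Y :=
    he.1.contDiffAt (e.open_target.mem_nhds hY.1)
  refine ((hg.comp Y h1).congr_of_eventuallyEq ?_).contDiffWithinAt
  filter_upwards [(e.continuousAt_symm hY.1).eventually hge] with Z hZ
  simp [hZ]

/-! ### Quotients of `Sp(1,1)` -/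

/-- `Sp(1) × {1}`, diagonally embedded: the matrices `diag(u, 1)` with `|u| = 1`. -/
def leftSubgroup : Subgroup Sp11 where
  carrier := {A | ∃ u : ℍ[ℝ], ‖u‖ = 1 ∧ (A : M₂) = !![u, 0; 0, 1]}
  one_mem' := ⟨1, by simp, by simp [Matrix.one_fin_two]⟩
  mul_mem' := by
    rintro A B ⟨u, hu, hA⟩ ⟨v, hv, hB⟩
    exact ⟨u * v, by simp [hu, hv], by rw [Submonoid.coe_mul, hA, hB]; simp⟩
  inv_mem' := by
    rintro A ⟨u, hu, hA⟩
    refine ⟨star u, by simpa using hu, ?_⟩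
    change J * (A : M₂)ᴴ * J = _
    rw [hA]
    exact Matrix.ext fun i j => by
      fin_cases i <;> fin_cases j <;>
        simp [J, Matrix.mul_apply, Matrix.vecMul, Matrix.vecHead, Matrix.vecTail]

/-- `Sp(1) I₂`: the scalar matrices `u I₂` with `|u| = 1`. -/
def rightSubgroup : Subgroup Sp11 where
  carrier := {A | ∃ u : ℍ[ℝ], ‖u‖ = 1 ∧ (A : M₂) = !![u, 0; 0, u]}
  one_mem' := ⟨1, by simp, by simp [Matrix.one_fin_two]⟩
  mul_mem' := by
    rintro A B ⟨u, hu, hA⟩ ⟨v, hv, hB⟩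
    exact ⟨u * v, by simp [hu, hv], by rw [Submonoid.coe_mul, hA, hB]; simp⟩
  inv_mem' := by
    rintro A ⟨u, hu, hA⟩
    refine ⟨star u, by simpa using hu, ?_⟩
    change J * (A : M₂)ᴴ * J = _
    rw [hA]
    exact Matrix.ext fun i j => by
      fin_cases i <;> fin_cases j <;>
        simp [J, Matrix.mul_apply, Matrix.vecMul, Matrix.vecHead, Matrix.vecTail]

/-- The double coset space `(Sp(1) × {1}) \ Sp(1,1) / Sp(1) I₂`. -/
abbrev DCoset : Type := DoubleCoset.Quotient (leftSubgroup : Set Sp11) rightSubgroup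

/-- The projection `A ↦ (Sp(1) × {1}) A Sp(1) I₂`. -/
def proj (A : Sp11) : DCoset := DoubleCoset.mk leftSubgroup rightSubgroup A

/-- The quotient topology. -/
instance : TopologicalSpace DCoset := TopologicalSpace.coinduced proj inferInstance

/-- A submersion: a surjective smooth map whose differential is surjective at every point. -/
structure IsSubmersion {E E' H H' : Type*}
    [NormedAddCommGroup E] [NormedSpace ℝ E] [TopologicalSpace H]
    [NormedAddCommGroup E'] [NormedSpace ℝ E'] [TopologicalSpace H']
    (I : ModelWithCorners ℝ E H) (I' : ModelWithCorners ℝ E' H')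
    {M N : Type*} [TopologicalSpace M] [ChartedSpace H M]
    [TopologicalSpace N] [ChartedSpace H' N] (f : M → N) : Prop where
  contMDiff : ContMDiff I I' ∞ f
  surjective : Function.Surjective f
  mfderiv_surjective : ∀ x, Function.Surjective (mfderiv I I' f x)

/-- A charted space structure on the double coset space (with its quotient topology) is a natural
manifold structure if it is smooth and the projection from `Sp(1,1)` is a submersion. -/
structure IsNaturalStructure {n : ℕ} (cs : ChartedSpace (EuclideanSpace ℝ (Fin n)) DCoset) :
    Prop where
  isManifold : IsManifold (𝓡 n) ∞ DCoset
  isSubmersion : IsSubmersion 𝓘(ℝ, sp11) (𝓡 n) proj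

/-! ### The regular product and regular Möbius transformations -/

/-- The open unit ball of `ℍ`, as an open submanifold. -/
def ball : TopologicalSpace.Opens ℍ[ℝ] := ⟨Metric.ball 0 1, Metric.isOpen_ball⟩

/-- `f(q) = ∑ qⁿ aₙ` on the unit ball. The sequence of (right) coefficients is recorded as a
power series in a central variable, whose product is `cₙ = ∑ₖ aₖ bₙ₋ₖ`. -/
def HasExpansion (f : ℍ[ℝ] → ℍ[ℝ]) (a : PowerSeries ℍ[ℝ]) : Prop :=
  ∀ q ∈ ball, HasSum (fun n : ℕ => q ^ n * PowerSeries.coeff n a) (f q)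

/-- The (unique) coefficients of `f`; by convention `0` if `f` has no expansion. -/
def expansion (f : ℍ[ℝ] → ℍ[ℝ]) : PowerSeries ℍ[ℝ] :=
  open Classical in if h : ∃ a, HasExpansion f a then h.choose else 0

/-- The function `q ↦ ∑ qⁿ aₙ`. -/
def evalSeries (a : PowerSeries ℍ[ℝ]) (q : ℍ[ℝ]) : ℍ[ℝ] :=
  ∑' n : ℕ, q ^ n * PowerSeries.coeff n a

/-- The regular product `(f * g)(q) = ∑ qⁿ cₙ`, `cₙ = ∑ₖ aₖ bₙ₋ₖ`. -/
def starMul (f g : ℍ[ℝ] → ℍ[ℝ]) : ℍ[ℝ] → ℍ[ℝ] :=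
  evalSeries (expansion f * expansion g)

/-- The regular conjugate `f^c(q) = ∑ qⁿ āₙ`. -/
def regConj (f : ℍ[ℝ] → ℍ[ℝ]) : ℍ[ℝ] → ℍ[ℝ] :=
  evalSeries (PowerSeries.mk fun n => star (PowerSeries.coeff n (expansion f)))

/-- The symmetrization `f^s = f * f^c`. -/
def symmetrization (f : ℍ[ℝ] → ℍ[ℝ]) : ℍ[ℝ] → ℍ[ℝ] := starMul f (regConj f)

/-- The regular reciprocal `f^{-*} = (1 / f^s) f^c`. -/
def regInv (f : ℍ[ℝ] → ℍ[ℝ]) : ℍ[ℝ] → ℍ[ℝ] := fun q => (symmetrization f q)⁻¹ * regConj f q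

/-- `l_{(a,b)}(q) = q a + b`. -/
def lin (a b : ℍ[ℝ]) : ℍ[ℝ] → ℍ[ℝ] := fun q => q * a + b

/-- The regular Möbius transformation `𝓕_A = l_{(c,d)}^{-*} * l_{(a,b)}` of a matrix `A` with rows
`(a, c)` and `(b, d)`. Only its values on the unit ball are meaningful. -/
def regMobius (A : Sp11) : ℍ[ℝ] → ℍ[ℝ] :=
  starMul (regInv (lin ((A : M₂) 0 1) ((A : M₂) 1 1))) (lin ((A : M₂) 0 0) ((A : M₂) 1 0))

end RegMobius

end

open RegMobius

/-!
Let `A` have rows `(a, c)` and `(b, d)`. For `q` in the ball, the value `s` at `q` of the regular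
reciprocal of `l_{(c,d)}` is the only solution of `q s c + s d = 1`, and `𝓕_A(q) = q s a + s b`; in
other words `𝓕_A(q)` is characterised by an identity of row vectors `(q s, s) A = (𝓕_A(q), 1)`.
Multiplying by `A⁻¹` shows that `𝓕_{A⁻¹}` inverts `w ↦ (w a + b) (w c + d)⁻¹`, and both maps
preserve the ball because `A` preserves `|x|² - |y|²` on row vectors `(x, y)`.

In particular the zero of `𝓕_{A⁻¹}` is `b d⁻¹`. As `|d|⁻² = 1 - |b d⁻¹|²`, this point determines
`(b, d)` up to a unit factor on the right, and `(b, d)` determines `A` up to `Sp(1) × {1}`, so the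
fibres of `A ↦ b d⁻¹` are exactly the double cosets. The matrices `(1 - |t|²)^{-1/2} (1, t̄; t, 1)`
form a smooth section of this map, and translating it gives a smooth section through every point,
so the coordinates of the ball make the projection a submersion. A submersion has local smooth
sections, so a map out of its target is smooth as soon as its composite with it is, whence
uniqueness.
-/

noncomputable section

namespace RegMobius

/-! ### Row vectors under `Sp(1,1)` -/

lemma vecMul_fin_two {R : Type*} [NonUnitalNonAssocSemiring R] (x y : R)
    (A : Matrix (Fin 2) (Fin 2) R) :
    ![x, y] ᵥ* A = ![x * A 0 0 + y * A 1 0, x * A 0 1 + y * A 1 1] := by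
  ext j
  fin_cases j <;> simp [Matrix.vecMul, dotProduct, Fin.sum_univ_two]

lemma vecMul_J_dotProduct_star (v : Fin 2 → ℍ[ℝ]) :
    v ᵥ* J ⬝ᵥ star v = ((‖v 0‖ ^ 2 - ‖v 1‖ ^ 2 : ℝ) : ℍ[ℝ]) := by
  simp [J, Matrix.vecMul, dotProduct, Fin.sum_univ_two, Quaternion.self_mul_star,
    Quaternion.normSq_eq_norm_mul_self, sq, sub_eq_add_neg]

lemma coe_mul_J_mul_conjTranspose (A : Sp11) : (A : M₂) * J * (A : M₂)ᴴ = J := by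
  have h : (A : M₂) * (J * (A : M₂)ᴴ * J) = 1 := coe_mul_inv A
  rw [← mul_one (_ * _), ← J_mul_J, ← mul_assoc, mul_assoc (A : M₂), mul_assoc (A : M₂), h, one_mul]

lemma norm_sq_sub_norm_sq_vecMul (A : Sp11) (v : Fin 2 → ℍ[ℝ]) :
    ‖(v ᵥ* (A : M₂)) 0‖ ^ 2 - ‖(v ᵥ* (A : M₂)) 1‖ ^ 2 = ‖v 0‖ ^ 2 - ‖v 1‖ ^ 2 := by
  rw [← Quaternion.coe_inj, ← vecMul_J_dotProduct_star, ← vecMul_J_dotProduct_star,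
    Matrix.star_vecMul, Matrix.dotProduct_mulVec, Matrix.vecMul_vecMul, Matrix.vecMul_vecMul,
    ← mul_assoc, coe_mul_J_mul_conjTranspose]

lemma vecMul_eq_iff (A : Sp11) {u v : Fin 2 → ℍ[ℝ]} :
    u ᵥ* (A : M₂) = v ↔ u = v ᵥ* ((A⁻¹ : Sp11) : M₂) := by
  constructor <;> rintro rfl
  · rw [Matrix.vecMul_vecMul, coe_mul_inv, Matrix.vecMul_one]
  · rw [Matrix.vecMul_vecMul, coe_inv_mul, Matrix.vecMul_one]

lemma coe_inv (A : Sp11) : ((A⁻¹ : Sp11) : M₂) =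
    !![star ((A : M₂) 0 0), -star ((A : M₂) 1 0); -star ((A : M₂) 0 1), star ((A : M₂) 1 1)] := by
  change J * (A : M₂)ᴴ * J = _
  exact Matrix.ext fun i j => by
    fin_cases i <;> fin_cases j <;>
      simp [J, Matrix.mul_apply, Matrix.vecMul, Matrix.vecHead, Matrix.vecTail]

lemma norm_sq_sub_norm_sq_snd_row (A : Sp11) : ‖(A : M₂) 1 0‖ ^ 2 - ‖(A : M₂) 1 1‖ ^ 2 = -1 := by
  simpa [vecMul_fin_two] using norm_sq_sub_norm_sq_vecMul A ![0, 1]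

lemma norm_apply_one_zero_lt (A : Sp11) : ‖(A : M₂) 1 0‖ < ‖(A : M₂) 1 1‖ := by
  rw [← sq_lt_sq₀ (norm_nonneg _) (norm_nonneg _)]
  linarith [norm_sq_sub_norm_sq_snd_row A]

lemma norm_apply_zero_one_lt (A : Sp11) : ‖(A : M₂) 0 1‖ < ‖(A : M₂) 1 1‖ := by
  simpa [coe_inv] using norm_apply_one_zero_lt A⁻¹

lemma mem_ball_iff {q : ℍ[ℝ]} : q ∈ ball ↔ ‖q‖ < 1 := mem_ball_zero_iff

lemma norm_mul_norm_lt_of_mem_ball {c d q : ℍ[ℝ]} (hq : q ∈ ball) (h : ‖c‖ < ‖d‖) :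
    ‖q‖ * ‖c‖ < ‖d‖ :=
  (mul_le_of_le_one_left (norm_nonneg c) (mem_ball_iff.1 hq).le).trans_lt h

lemma mul_add_ne_zero {D : Type*} [NormedDivisionRing D] {q c d : D} (h : ‖q‖ * ‖c‖ < ‖d‖) :
    q * c + d ≠ 0 := by
  rw [← norm_mul] at h
  exact fun h0 => h.ne (by rw [eq_neg_of_add_eq_zero_left h0, norm_neg])

/-! ### Power series evaluated with the variable on the left -/

/-- `a = ∑ Xⁿ aₙ` converges to `s` when the non-central value `q` is substituted for `X`,
with the powers of `q` to the left of the coefficients. -/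
def HasLeftEval {R : Type*} [Semiring R] [TopologicalSpace R] (q : R) (a : PowerSeries R) (s : R) :
    Prop :=
  HasSum (fun n : ℕ => q ^ n * PowerSeries.coeff n a) s

/-- The power series `X a + b`. -/
def linSeries {R : Type*} [Semiring R] (a b : R) : PowerSeries R :=
  PowerSeries.X * PowerSeries.C a + PowerSeries.C b

/-- The inverse of the power series `X c + d`, for `d ≠ 0`. -/
def linInvSeries {D : Type*} [DivisionRing D] (c d : D) : PowerSeries D :=
  PowerSeries.mk fun n => (-(d⁻¹ * c)) ^ n * d⁻¹

section HasLeftEval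

variable {R : Type*} [Semiring R] [TopologicalSpace R] {q s t : R} {a b : PowerSeries R}

lemma HasLeftEval.unique [T2Space R] (hs : HasLeftEval q a s) (ht : HasLeftEval q a t) : s = t :=
  HasSum.unique hs ht

lemma hasLeftEval_one (q : R) : HasLeftEval q 1 1 := by
  simpa [HasLeftEval] using hasSum_single (f := fun n => q ^ n * PowerSeries.coeff n 1) 0
    fun n hn => by simp [PowerSeries.coeff_one, hn]

variable [IsTopologicalSemiring R]

lemma HasLeftEval.add (ha : HasLeftEval q a s) (hb : HasLeftEval q b t) :
    HasLeftEval q (a + b) (s + t) := by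
  simpa only [HasLeftEval, map_add, mul_add] using HasSum.add ha hb

lemma HasLeftEval.mul_C (ha : HasLeftEval q a s) (x : R) :
    HasLeftEval q (a * PowerSeries.C x) (s * x) := by
  simpa only [HasLeftEval, PowerSeries.coeff_mul_C, mul_assoc] using HasSum.mul_right x ha

lemma HasLeftEval.X_mul (ha : HasLeftEval q a s) : HasLeftEval q (PowerSeries.X * a) (q * s) := by
  have h : ∀ n ∉ Set.range Nat.succ, q ^ n * PowerSeries.coeff n (PowerSeries.X * a) = 0 := by
    simp
  rw [HasLeftEval, ← Nat.succ_injective.hasSum_iff h]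
  simpa [Function.comp_def, PowerSeries.coeff_succ_X_mul, pow_succ', mul_assoc] using
    HasSum.mul_left q ha

lemma HasLeftEval.mul_linSeries (ha : HasLeftEval q a s) (x y : R) :
    HasLeftEval q (a * linSeries x y) (q * s * x + s * y) := by
  rw [linSeries, mul_add, ← mul_assoc, ← PowerSeries.X_mul]
  exact (ha.X_mul.mul_C x).add (ha.mul_C y)

lemma hasLeftEval_linSeries (q x y : R) : HasLeftEval q (linSeries x y) (q * x + y) := by
  simpa only [one_mul, mul_one] using (hasLeftEval_one q).mul_linSeries x y

end HasLeftEval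

lemma linInvSeries_mul_linSeries {D : Type*} [DivisionRing D] {d : D} (c : D) (hd : d ≠ 0) :
    linInvSeries c d * linSeries c d = 1 := by
  rw [linSeries, mul_add, ← mul_assoc, ← PowerSeries.X_mul, mul_assoc]
  ext1 n
  rcases n with _ | n
  · simp [linInvSeries, hd]
  · simp [PowerSeries.coeff_succ_X_mul, linInvSeries, PowerSeries.coeff_one, hd, pow_succ,
      mul_assoc]

lemma summable_linInvSeries {D : Type*} [NormedDivisionRing D] [CompleteSpace D] {c d q : D}
    (h : ‖q‖ * ‖c‖ < ‖d‖) :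
    Summable fun n : ℕ => q ^ n * PowerSeries.coeff n (linInvSeries c d) := by
  have hd : 0 < ‖d‖ := (by positivity : 0 ≤ ‖q‖ * ‖c‖).trans_lt h
  have hr : ‖q‖ * ‖d⁻¹ * c‖ < 1 := by
    rwa [norm_mul, norm_inv, mul_left_comm, inv_mul_lt_one₀ hd]
  refine Summable.of_norm_bounded
    ((summable_geometric_of_lt_one (by positivity) hr).mul_right ‖d⁻¹‖) fun n => ?_
  simp [linInvSeries, mul_pow, mul_assoc]

lemma exists_hasLeftEval_linInvSeries {D : Type*} [NormedDivisionRing D] [CompleteSpace D]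
    {c d q : D} (h : ‖q‖ * ‖c‖ < ‖d‖) :
    ∃ s, HasLeftEval q (linInvSeries c d) s ∧ q * s * c + s * d = 1 := by
  have hd : d ≠ 0 := norm_pos_iff.1 ((by positivity : 0 ≤ ‖q‖ * ‖c‖).trans_lt h)
  obtain ⟨s, hs⟩ : ∃ s, HasLeftEval q (linInvSeries c d) s := summable_linInvSeries h
  have hmul := hs.mul_linSeries c d
  rw [linInvSeries_mul_linSeries c hd] at hmul
  exact ⟨s, hs, hmul.unique (hasLeftEval_one q)⟩

/-! ### The regular Möbius transformations -/

/-- The restriction of `∑ qⁿ aₙ` to the real axis, as a formal multilinear series; it transfers the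
uniqueness of coefficients from real power series. -/
def realSeries (a : PowerSeries ℍ[ℝ]) : FormalMultilinearSeries ℝ ℝ ℍ[ℝ] :=
  fun n => ContinuousMultilinearMap.mkPiRing ℝ (Fin n) (PowerSeries.coeff n a)

lemma coeff_realSeries (a : PowerSeries ℍ[ℝ]) (n : ℕ) :
    (realSeries a).coeff n = PowerSeries.coeff n a := by
  simp [realSeries, FormalMultilinearSeries.coeff]

lemma HasExpansion.hasFPowerSeriesAt {f : ℍ[ℝ] → ℍ[ℝ]} {a : PowerSeries ℍ[ℝ]}
    (h : HasExpansion f a) : HasFPowerSeriesAt (fun r : ℝ => f (r : ℍ[ℝ])) (realSeries a) 0 := by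
  rw [hasFPowerSeriesAt_iff]
  filter_upwards [Metric.ball_mem_nhds (0 : ℝ) one_pos] with r hr
  have hr' : (r : ℍ[ℝ]) ∈ ball := by
    rw [mem_ball_iff, Quaternion.norm_coe]
    exact mem_ball_zero_iff.1 hr
  have hsum := h _ hr'
  simp only [← Quaternion.coe_pow, Quaternion.coe_mul_eq_smul] at hsum
  simpa only [coeff_realSeries, zero_add] using hsum

lemma HasExpansion.unique {f : ℍ[ℝ] → ℍ[ℝ]} {a b : PowerSeries ℍ[ℝ]} (ha : HasExpansion f a)
    (hb : HasExpansion f b) : a = b := by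
  have h := ha.hasFPowerSeriesAt.eq_formalMultilinearSeries hb.hasFPowerSeriesAt
  ext1 n
  rw [← coeff_realSeries, h, coeff_realSeries]

lemma HasExpansion.expansion_eq {f : ℍ[ℝ] → ℍ[ℝ]} {a : PowerSeries ℍ[ℝ]} (h : HasExpansion f a) :
    expansion f = a := by
  have h' : ∃ a, HasExpansion f a := ⟨a, h⟩
  rw [expansion, dif_pos h']
  exact h'.choose_spec.unique h

lemma HasLeftEval.evalSeries_eq {q s : ℍ[ℝ]} {a : PowerSeries ℍ[ℝ]} (h : HasLeftEval q a s) :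
    evalSeries a q = s :=
  h.tsum_eq

lemma expansion_lin (c d : ℍ[ℝ]) : expansion (lin c d) = linSeries c d :=
  HasExpansion.expansion_eq fun q _ => hasLeftEval_linSeries q c d

lemma regConj_lin (c d : ℍ[ℝ]) : regConj (lin c d) = lin (star c) (star d) := by
  have h : (PowerSeries.mk fun n => star (PowerSeries.coeff n (expansion (lin c d))))
      = linSeries (star c) (star d) := by
    rw [expansion_lin]
    ext1 n
    by_cases h : n = 1 <;>
      simp [linSeries, PowerSeries.coeff_X, PowerSeries.coeff_C, apply_ite star, h]
  funext q
  rw [regConj, h, (hasLeftEval_linSeries q _ _).evalSeries_eq, lin]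

lemma symmetrization_lin (c d q : ℍ[ℝ]) :
    symmetrization (lin c d) q = q * (q * c + d) * star c + (q * c + d) * star d := by
  rw [symmetrization, regConj_lin, starMul, expansion_lin, expansion_lin]
  exact ((hasLeftEval_linSeries q c d).mul_linSeries _ _).evalSeries_eq

lemma symmetrization_lin_mul {c d q s : ℍ[ℝ]} (h : q * s * c + s * d = 1) :
    symmetrization (lin c d) q * s = q * star c + star d := by
  have hcc : c * star c * s = s * (c * star c) := by
    rw [Quaternion.self_mul_star]; exact Quaternion.coe_commutes _ _
  have hdd : d * star d * s = s * (d * star d) := by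
    rw [Quaternion.self_mul_star]; exact Quaternion.coe_commutes _ _
  have hcd : (d * star c + c * star d) * s = s * (d * star c + c * star d) := by
    have hre : d * star c + c * star d = ((2 * (d * star c).re : ℝ) : ℍ[ℝ]) := by
      rw [← Quaternion.self_add_star', star_mul, star_star]
    rw [hre]; exact Quaternion.coe_commutes _ _
  calc symmetrization (lin c d) q * s
      = q * q * (c * star c * s) + q * ((d * star c + c * star d) * s) + d * star d * s := by
        rw [symmetrization_lin]; noncomm_ring
    _ = q * (q * s * c + s * d) * star c + (q * s * c + s * d) * star d := by
        rw [hcc, hdd, hcd]; noncomm_ring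
    _ = q * star c + star d := by rw [h, mul_one, one_mul]

lemma regInv_lin_eq {c d q s : ℍ[ℝ]} (hq : ‖q‖ * ‖c‖ < ‖d‖) (h : q * s * c + s * d = 1) :
    regInv (lin c d) q = s := by
  have hs := symmetrization_lin_mul h
  have h0 : q * star c + star d ≠ 0 := mul_add_ne_zero (by simpa only [norm_star] using hq)
  rw [regInv, regConj_lin, lin, ← hs, inv_mul_cancel_left₀ (left_ne_zero_of_mul (hs ▸ h0))]

lemma hasLeftEval_regInv_lin {c d q : ℍ[ℝ]} (hq : ‖q‖ * ‖c‖ < ‖d‖) :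
    HasLeftEval q (linInvSeries c d) (regInv (lin c d) q) := by
  obtain ⟨s, hs, h⟩ := exists_hasLeftEval_linInvSeries hq
  rwa [regInv_lin_eq hq h]

lemma mul_regInv_lin {c d q : ℍ[ℝ]} (hq : ‖q‖ * ‖c‖ < ‖d‖) :
    q * regInv (lin c d) q * c + regInv (lin c d) q * d = 1 := by
  obtain ⟨s, -, h⟩ := exists_hasLeftEval_linInvSeries hq
  rwa [regInv_lin_eq hq h]

lemma expansion_regInv_lin {c d : ℍ[ℝ]} (h : ‖c‖ < ‖d‖) :
    expansion (regInv (lin c d)) = linInvSeries c d :=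
  HasExpansion.expansion_eq fun _ hq => hasLeftEval_regInv_lin (norm_mul_norm_lt_of_mem_ball hq h)

lemma starMul_regInv_lin {c d q : ℍ[ℝ]} (h : ‖c‖ < ‖d‖) (hq : q ∈ ball) (a b : ℍ[ℝ]) :
    starMul (regInv (lin c d)) (lin a b) q
      = q * regInv (lin c d) q * a + regInv (lin c d) q * b := by
  rw [starMul, expansion_regInv_lin h, expansion_lin]
  have hs := hasLeftEval_regInv_lin (norm_mul_norm_lt_of_mem_ball hq h)
  exact (hs.mul_linSeries a b).evalSeries_eq

lemma regMobius_eq_iff (A : Sp11) {q w : ℍ[ℝ]} (hq : q ∈ ball) :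
    regMobius A q = w ↔ ∃ s, ![q * s, s] ᵥ* (A : M₂) = ![w, 1] := by
  have h := norm_apply_zero_one_lt A
  have hq' := norm_mul_norm_lt_of_mem_ball hq h
  rw [regMobius, starMul_regInv_lin h hq]
  constructor
  · rintro rfl
    exact ⟨_, by rw [vecMul_fin_two, mul_regInv_lin hq']⟩
  · rintro ⟨s, hs⟩
    rw [vecMul_fin_two] at hs
    have hs' : q * s * (A : M₂) 0 1 + s * (A : M₂) 1 1 = 1 := congrFun hs 1
    rw [regInv_lin_eq hq' hs']
    exact congrFun hs 0

lemma mem_ball_iff_of_vecMul_eq {A : Sp11} {q s w : ℍ[ℝ]} (h : ![q * s, s] ᵥ* (A : M₂) = ![w, 1]) :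
    q ∈ ball ↔ w ∈ ball := by
  have hs : 0 < ‖s‖ ^ 2 := by
    have h0 : s ≠ 0 := by
      rintro rfl
      simpa [vecMul_fin_two] using congrFun h 1
    positivity
  have hform : 1 - ‖w‖ ^ 2 = ‖s‖ ^ 2 * (1 - ‖q‖ ^ 2) := by
    have := norm_sq_sub_norm_sq_vecMul A ![q * s, s]
    simp only [h, Matrix.cons_val_zero, Matrix.cons_val_one, norm_mul, norm_one] at this
    linarith
  rw [mem_ball_iff, mem_ball_iff, ← sq_lt_one_iff₀ (norm_nonneg q),
    ← sq_lt_one_iff₀ (norm_nonneg w), ← sub_pos (b := ‖q‖ ^ 2), ← sub_pos (b := ‖w‖ ^ 2), hform,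
    mul_pos_iff_of_pos_left hs]

/-- The classical fractional linear transformation `w ↦ (w a + b)(w c + d)⁻¹` of `A`. -/
def fracLin (A : Sp11) (w : ℍ[ℝ]) : ℍ[ℝ] :=
  (w * (A : M₂) 0 0 + (A : M₂) 1 0) * (w * (A : M₂) 0 1 + (A : M₂) 1 1)⁻¹

lemma mul_apply_add_apply_ne_zero (A : Sp11) {w : ℍ[ℝ]} (hw : w ∈ ball) :
    w * (A : M₂) 0 1 + (A : M₂) 1 1 ≠ 0 :=
  mul_add_ne_zero (norm_mul_norm_lt_of_mem_ball hw (norm_apply_zero_one_lt A))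

lemma eq_fracLin_iff (A : Sp11) {q w : ℍ[ℝ]} (hw : w ∈ ball) :
    q = fracLin A w ↔ ∃ s, ![q * s, s] ᵥ* ((A⁻¹ : Sp11) : M₂) = ![w, 1] := by
  have h0 := mul_apply_add_apply_ne_zero A hw
  simp only [vecMul_eq_iff, inv_inv, vecMul_fin_two w 1, one_mul, fracLin]
  rw [eq_mul_inv_iff_mul_eq₀ h0]
  simp

lemma regMobius_inv_eq_iff (A : Sp11) {q w : ℍ[ℝ]} (hw : w ∈ ball) :
    q ∈ ball ∧ regMobius A⁻¹ q = w ↔ q = fracLin A w := by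
  rw [eq_fracLin_iff A hw]
  constructor
  · rintro ⟨hq, h⟩
    exact (regMobius_eq_iff A⁻¹ hq).1 h
  · rintro ⟨s, hs⟩
    have hq : q ∈ ball := (mem_ball_iff_of_vecMul_eq hs).2 hw
    exact ⟨hq, (regMobius_eq_iff A⁻¹ hq).2 ⟨s, hs⟩⟩

lemma fracLin_mem_ball (A : Sp11) {w : ℍ[ℝ]} (hw : w ∈ ball) : fracLin A w ∈ ball :=
  ((regMobius_inv_eq_iff A hw).2 rfl).1

lemma regMobius_mem_ball (A : Sp11) {q : ℍ[ℝ]} (hq : q ∈ ball) : regMobius A q ∈ ball :=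
  let ⟨_, hs⟩ := (regMobius_eq_iff A hq).1 rfl
  (mem_ball_iff_of_vecMul_eq hs).1 hq

theorem regMobius_bijOn (A : Sp11) : Set.BijOn (regMobius A) ball ball := by
  have hinv : Set.InvOn (fracLin A⁻¹) (regMobius A) ball ball := by
    constructor
    · intro q hq
      have h := regMobius_inv_eq_iff A⁻¹ (q := q) (regMobius_mem_ball A hq)
      exact (h.1 ⟨hq, by rw [inv_inv]⟩).symm
    · intro w hw
      simpa only [inv_inv] using ((regMobius_inv_eq_iff A⁻¹ hw).2 rfl).2
  exact hinv.bijOn (fun _ => regMobius_mem_ball A) fun _ => fracLin_mem_ball A⁻¹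

/-! ### Submersions -/

section Submersion

lemma mfderiv_surjective_of_eventually_rightInverse {𝕜 : Type*} [NontriviallyNormedField 𝕜]
    {E E' H H' M N : Type*} [NormedAddCommGroup E] [NormedSpace 𝕜 E] [NormedAddCommGroup E']
    [NormedSpace 𝕜 E'] [TopologicalSpace H] [TopologicalSpace H'] [TopologicalSpace M]
    [ChartedSpace H M] [TopologicalSpace N] [ChartedSpace H' N] {I : ModelWithCorners 𝕜 E H}
    {I' : ModelWithCorners 𝕜 E' H'} {f : M → N} {s : N → M} {x : M} (hsx : s (f x) = x)
    (hf : MDifferentiableAt I I' f x) (hs : MDifferentiableAt I' I s (f x))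
    (hfs : ∀ᶠ y in 𝓝 (f x), f (s y) = y) : Function.Surjective (mfderiv I I' f x) := by
  rw [← hsx] at hf
  have hcomp := (hf.hasMFDerivAt.comp (f x) hs.hasMFDerivAt).congr_of_eventuallyEq
    (hfs.mono fun _ hy => hy.symm)
  have hid := hasMFDerivAt_unique hcomp (hasMFDerivAt_id (f x))
  rw [hsx] at hid
  exact fun v => ⟨mfderiv I' I s (f x) v, DFunLike.congr_fun hid v⟩

variable {𝕜 : Type*} [RCLike 𝕜]
  {E F : Type*} [NormedAddCommGroup E] [NormedSpace 𝕜 E] [NormedAddCommGroup F] [NormedSpace 𝕜 F]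

lemma exists_contDiffAt_rightInverse [CompleteSpace F] {f : E → F} {a : E} {n : ℕ∞ω}
    (hf : ContDiffAt 𝕜 n f a) (hn : n ≠ 0) (hinv : (fderiv 𝕜 f a).HasRightInverse) :
    ∃ s : F → E, ContDiffAt 𝕜 n s (f a) ∧ s (f a) = a ∧ ∀ᶠ y in 𝓝 (f a), f (s y) = y := by
  obtain ⟨R, hR⟩ := hinv
  set g : F → E := fun v => a + R v
  have hg0 : g 0 = a := by simp [g]
  have hg : ContDiff 𝕜 n g := contDiff_const.add R.contDiff
  have hfg : ContDiffAt 𝕜 n (f ∘ g) 0 := (hg0.symm ▸ hf).comp 0 hg.contDiffAt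
  have hderiv : HasFDerivAt (f ∘ g) (ContinuousLinearEquiv.refl 𝕜 F : F →L[𝕜] F) 0 := by
    have hf' : HasFDerivAt f (fderiv 𝕜 f a) (g 0) := by
      rw [hg0]; exact (hf.differentiableAt hn).hasFDerivAt
    have h := hf'.comp 0 (R.hasFDerivAt.const_add a)
    rwa [show (fderiv 𝕜 f a).comp R = ContinuousLinearEquiv.refl 𝕜 F from
      ContinuousLinearMap.ext hR] at h
  have h0 : (f ∘ g) 0 = f a := congrArg f hg0
  rw [← h0]
  refine ⟨g ∘ hfg.localInverse hderiv hn, ?_, ?_, ?_⟩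
  · exact hg.contDiffAt.comp _ (hfg.to_localInverse hderiv hn)
  · rw [Function.comp_apply, hfg.localInverse_apply_image hderiv hn, hg0]
  · exact (hfg.hasStrictFDerivAt' hderiv hn).eventually_right_inverse

variable {H H' M N : Type*} [TopologicalSpace H] [TopologicalSpace H']
  {I : ModelWithCorners 𝕜 E H} {I' : ModelWithCorners 𝕜 F H'}
  [TopologicalSpace M] [ChartedSpace H M] [TopologicalSpace N] [ChartedSpace H' N]

lemma exists_contMDiffAt_rightInverse [CompleteSpace F] [I.Boundaryless] {n : ℕ∞ω}
    [IsManifold I n M] {p : M → N} {x : M} (hp : ContMDiffAt I I' n p x)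
    (hn : n ≠ 0) (hinv : (mfderiv I I' p x : E →L[𝕜] F).HasRightInverse) :
    ∃ s : N → M, ContMDiffAt I' I n s (p x) ∧ s (p x) = x ∧ ∀ᶠ y in 𝓝 (p x), p (s y) = y := by
  set φ := extChartAt I x
  set χ := extChartAt I' (p x)
  have hpχ : χ (p (φ.symm (φ x))) = χ (p x) := by rw [extChartAt_to_inv]
  have hf : ContDiffAt 𝕜 n (χ ∘ p ∘ φ.symm) (φ x) := by
    simpa only [I.range_eq_univ, contDiffWithinAt_univ] using (contMDiffAt_iff.1 hp).2
  have hder : (fderiv 𝕜 (χ ∘ p ∘ φ.symm) (φ x)).HasRightInverse := by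
    rwa [(hp.mdifferentiableAt hn).mfderiv, I.range_eq_univ, fderivWithin_univ] at hinv
  obtain ⟨s, hs, hsx, hps⟩ := exists_contDiffAt_rightInverse hf hn hder
  simp only [Function.comp_apply, hpχ] at hs hsx hps
  have hσx : φ.symm (s (χ (p x))) = x := by rw [hsx, extChartAt_to_inv]
  have hσ : ContMDiffAt I' I n (φ.symm ∘ s ∘ χ) (p x) := by
    have hφ : ContMDiffAt 𝓘(𝕜, E) I n φ.symm (s (χ (p x))) := by
      rw [hsx]
      exact (contMDiffOn_extChartAt_symm x).contMDiffAt (extChartAt_target_mem_nhds x)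
    exact hφ.comp (p x) (hs.contMDiffAt.comp (p x) contMDiffAt_extChartAt)
  refine ⟨φ.symm ∘ s ∘ χ, hσ, hσx, ?_⟩
  have hsource : ∀ᶠ y in 𝓝 (p x), p (φ.symm (s (χ y))) ∈ χ.source := by
    have hpσ : ContinuousAt p (φ.symm (s (χ (p x)))) := hσx.symm ▸ hp.continuousAt
    refine (hpσ.comp_of_eq hσ.continuousAt rfl).eventually_mem ?_
    rw [Function.comp_apply, Function.comp_apply, Function.comp_apply, hσx]
    exact extChartAt_source_mem_nhds (p x)
  filter_upwards [hsource, extChartAt_source_mem_nhds (I := I') (p x),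
    (continuousAt_extChartAt (p x)).eventually hps] with y hpy hy hχ
  exact χ.injOn hpy hy hχ

end Submersion

lemma IsSubmersion.contMDiff_of_comp {E E' E'' H H' H'' : Type*} [NormedAddCommGroup E]
    [NormedSpace ℝ E] [NormedAddCommGroup E'] [NormedSpace ℝ E'] [FiniteDimensional ℝ E']
    [NormedAddCommGroup E''] [NormedSpace ℝ E''] [TopologicalSpace H] [TopologicalSpace H']
    [TopologicalSpace H''] {I : ModelWithCorners ℝ E H} [I.Boundaryless]
    {I' : ModelWithCorners ℝ E' H'} {I'' : ModelWithCorners ℝ E'' H''} {M N P : Type*}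
    [TopologicalSpace M] [ChartedSpace H M] [IsManifold I ∞ M]
    [TopologicalSpace N] [ChartedSpace H' N]
    [TopologicalSpace P] [ChartedSpace H'' P] {p : M → N} {g : N → P} (hp : IsSubmersion I I' p)
    (hg : ContMDiff I I'' ∞ (g ∘ p)) : ContMDiff I' I'' ∞ g := by
  have := FiniteDimensional.complete ℝ E'
  intro y
  obtain ⟨x, rfl⟩ := hp.surjective y
  let dp : E →L[ℝ] E' := mfderiv I I' p x
  have hdp : dp.HasRightInverse :=
    ContinuousLinearMap.HasRightInverse.of_surjective_of_finiteDimensional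
      (hp.mfderiv_surjective x)
  obtain ⟨s, hs, -, hps⟩ := exists_contMDiffAt_rightInverse (hp.contMDiff x) (by simp) hdp
  have h : ContMDiffAt I' I'' ∞ ((g ∘ p) ∘ s) (p x) := (hg _).comp (p x) hs
  exact h.congr_of_eventuallyEq (hps.mono fun _ hz => congrArg g hz.symm)

/-! ### Smooth maps from and to `Sp(1,1)` -/

lemma contMDiff_coe_Sp11 : ContMDiff 𝓘(ℝ, sp11) 𝓘(ℝ, M₂) ∞ (fun A : Sp11 => (A : M₂)) := by
  intro A
  have hsymm : ContDiffAt ℝ ∞ (fun Y => (((chartAt sp11 A).symm Y : Sp11) : M₂))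
      (chartAt sp11 A A) :=
    (isSubmanifoldChart_cayleyChart A).1.contDiffAt (chart_target_mem_nhds sp11 A)
  have hchart : ContMDiffAt 𝓘(ℝ, sp11) 𝓘(ℝ, sp11) ∞ (chartAt sp11 A) A :=
    contMDiffOn_chart.contMDiffAt (chart_source_mem_nhds sp11 A)
  refine (hsymm.contMDiffAt.comp A hchart).congr_of_eventuallyEq ?_
  filter_upwards [chart_source_mem_nhds sp11 A] with B hB
  rw [Function.comp_apply, (chartAt sp11 A).left_inv hB]

lemma contMDiff_Sp11_iff {E H M : Type*} [NormedAddCommGroup E] [NormedSpace ℝ E]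
    [TopologicalSpace H] {I : ModelWithCorners ℝ E H} [TopologicalSpace M] [ChartedSpace H M]
    {f : M → Sp11} :
    ContMDiff I 𝓘(ℝ, sp11) ∞ f ↔ ContMDiff I 𝓘(ℝ, M₂) ∞ (fun x => (f x : M₂)) := by
  refine ⟨contMDiff_coe_Sp11.comp, fun hf x => ?_⟩
  have hcont : ContinuousAt f x :=
    Topology.IsInducing.subtypeVal.continuousAt_iff.2 (hf x).continuousAt
  obtain ⟨g, hg, hgf⟩ :=
    (isSubmanifoldChart_cayleyChart (f x)).2 (f x) (mem_chart_source sp11 (f x))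
  refine contMDiffAt_iff_target.2 ⟨hcont, ?_⟩
  exact (hg.contMDiffAt.comp x (hf x)).congr_of_eventuallyEq
    ((hcont.eventually hgf).mono fun _ hy => hy.symm)

lemma contMDiff_mul_mul (A B : Sp11) :
    ContMDiff 𝓘(ℝ, sp11) 𝓘(ℝ, sp11) ∞ (fun X => A * X * B) := by
  have h : ContDiff ℝ ∞ (fun X : M₂ => (A : M₂) * X * (B : M₂)) :=
    (contDiff_const.mul contDiff_id).mul contDiff_const
  exact contMDiff_Sp11_iff.2 (h.contMDiff.comp contMDiff_coe_Sp11)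

lemma contDiff_entry (i j : Fin 2) : ContDiff ℝ ∞ (fun X : M₂ => X i j) :=
  (Matrix.entryLinearMap ℝ ℍ[ℝ] i j : M₂ →ₗ[ℝ] ℍ[ℝ]).toContinuousLinearMap.contDiff

/-! ### Double cosets -/

lemma mem_leftSubgroup_iff {A : Sp11} : A ∈ leftSubgroup ↔ (A : M₂) 1 = ![0, 1] := by
  refine ⟨fun ⟨u, _, hA⟩ => by rw [hA]; rfl, fun hA => ?_⟩
  have hrow : ![0, 1] ᵥ* (A : M₂) = ![0, 1] := by simp [vecMul_fin_two, hA]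
  have h01 : (A : M₂) 0 1 = 0 := by
    simpa [vecMul_fin_two, coe_inv] using (congrFun ((vecMul_eq_iff A).1 hrow) 0).symm
  have h00 : ‖(A : M₂) 0 0‖ ^ 2 = 1 := by
    simpa [vecMul_fin_two, h01] using norm_sq_sub_norm_sq_vecMul A ![1, 0]
  refine ⟨(A : M₂) 0 0, (pow_eq_one_iff_of_nonneg (norm_nonneg _) two_ne_zero).1 h00, ?_⟩
  exact Matrix.ext fun i j => by fin_cases i <;> fin_cases j <;> simp [hA, h01]

lemma mul_inv_mem_leftSubgroup_iff {A B : Sp11} :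
    B * A⁻¹ ∈ leftSubgroup ↔ (B : M₂) 1 = (A : M₂) 1 := by
  have hA : ![0, 1] ᵥ* (A : M₂) = (A : M₂) 1 := by
    rw [vecMul_fin_two]
    funext j
    fin_cases j <;> simp
  rw [mem_leftSubgroup_iff, Submonoid.coe_mul, Matrix.mul_apply_eq_vecMul, vecMul_eq_iff,
    inv_inv, hA]

lemma scalar_mem_Sp11 {v : ℍ[ℝ]} (hv : ‖v‖ = 1) : !![v, 0; 0, v] ∈ Sp11 := by
  have h : star v * v = 1 := by
    rw [Quaternion.star_mul_self, Quaternion.normSq_eq_norm_mul_self, hv, mul_one,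
      Quaternion.coe_one]
  rw [mem_Sp11]
  exact Matrix.ext fun i j => by
    fin_cases i <;> fin_cases j <;> simp [J, Matrix.mul_apply, h]

lemma proj_eq_proj_iff_exists_snd_row_eq {A B : Sp11} :
    proj A = proj B ↔ ∃ v : ℍ[ℝ], ‖v‖ = 1 ∧ ∀ j, (B : M₂) 1 j = (A : M₂) 1 j * v := by
  have hrow {k : Sp11} {v : ℍ[ℝ]} (hk : (k : M₂) = !![v, 0; 0, v]) :
      B * (A * k)⁻¹ ∈ leftSubgroup ↔ ∀ j, (B : M₂) 1 j = (A : M₂) 1 j * v := by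
    rw [mul_inv_mem_leftSubgroup_iff, funext_iff]
    simp [hk, Matrix.mul_apply]
  rw [proj, proj, DoubleCoset.eq]
  constructor
  · rintro ⟨h, hh, k, ⟨v, hv, hk⟩, hB⟩
    rw [mul_assoc, ← mul_inv_eq_iff_eq_mul] at hB
    exact ⟨v, hv, (hrow hk).1 (hB ▸ hh)⟩
  · rintro ⟨v, hv, hB⟩
    let k : Sp11 := ⟨_, scalar_mem_Sp11 hv⟩
    exact ⟨B * (A * k)⁻¹, (hrow rfl).2 hB, k, ⟨v, hv, rfl⟩,
      by rw [mul_assoc, inv_mul_cancel_right]⟩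

lemma zero_mem_ball : (0 : ℍ[ℝ]) ∈ ball := Metric.mem_ball_self one_pos

/-- The zero `b d⁻¹` of the regular Möbius transformation of `A⁻¹`, where `(b, d)` is the second
row of `A`, as a point of the unit ball. -/
def toBall (A : Sp11) : ball := ⟨fracLin A 0, fracLin_mem_ball A zero_mem_ball⟩

lemma coe_toBall (A : Sp11) : (toBall A : ℍ[ℝ]) = (A : M₂) 1 0 * ((A : M₂) 1 1)⁻¹ := by
  simp [toBall, fracLin]

lemma apply_one_one_ne_zero (A : Sp11) : (A : M₂) 1 1 ≠ 0 := by
  simpa using mul_apply_add_apply_ne_zero A zero_mem_ball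

lemma norm_sq_mul_one_sub_norm_sq_toBall (A : Sp11) :
    ‖(A : M₂) 1 1‖ ^ 2 * (1 - ‖(toBall A : ℍ[ℝ])‖ ^ 2) = 1 := by
  have hd : ‖(A : M₂) 1 1‖ ≠ 0 := norm_ne_zero_iff.2 (apply_one_one_ne_zero A)
  rw [coe_toBall, norm_mul, norm_inv]
  field_simp
  linarith [norm_sq_sub_norm_sq_snd_row A]

lemma norm_apply_one_one_eq_of_toBall_eq {A B : Sp11} (h : toBall A = toBall B) :
    ‖(A : M₂) 1 1‖ = ‖(B : M₂) 1 1‖ := by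
  have hA := norm_sq_mul_one_sub_norm_sq_toBall A
  have hB := norm_sq_mul_one_sub_norm_sq_toBall B
  rw [← h] at hB
  exact (sq_eq_sq₀ (norm_nonneg _) (norm_nonneg _)).1
    (mul_right_cancel₀ (right_ne_zero_of_mul_eq_one hA) (hA.trans hB.symm))

lemma proj_eq_proj_iff {A B : Sp11} : proj A = proj B ↔ toBall A = toBall B := by
  rw [proj_eq_proj_iff_exists_snd_row_eq]
  have hdA := apply_one_one_ne_zero A
  have hdB := apply_one_one_ne_zero B
  constructor
  · rintro ⟨v, hv, hB⟩
    have hv0 : v ≠ 0 := norm_ne_zero_iff.1 (hv ▸ one_ne_zero)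
    rw [Subtype.ext_iff, coe_toBall, coe_toBall, hB, hB, mul_inv_rev, mul_assoc,
      mul_inv_cancel_left₀ hv0]
  · intro h
    refine ⟨((A : M₂) 1 1)⁻¹ * (B : M₂) 1 1, ?_, Fin.forall_fin_two.2 ⟨?_, ?_⟩⟩
    · rw [norm_mul, norm_inv, norm_apply_one_one_eq_of_toBall_eq h,
        inv_mul_cancel₀ (norm_ne_zero_iff.2 hdB)]
    · rw [Subtype.ext_iff, coe_toBall, coe_toBall, eq_mul_inv_iff_mul_eq₀ hdB] at h
      rw [← h, mul_assoc]
    · rw [mul_inv_cancel_left₀ hdA]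

lemma contMDiff_toBall : ContMDiff 𝓘(ℝ, sp11) 𝓘(ℝ, ℍ[ℝ]) ∞ toBall := by
  rw [← ContMDiff.subtypeVal_comp_iff]
  intro A
  have hinv : ContDiffAt ℝ ∞ Ring.inverse ((A : M₂) 1 1) :=
    contDiffAt_ringInverse ℝ (Units.mk0 _ (apply_one_one_ne_zero A))
  have hquot : ContDiffAt ℝ ∞ (fun X : M₂ => X 1 0 * Ring.inverse (X 1 1)) (A : M₂) :=
    (contDiff_entry 1 0).contDiffAt.mul
      (hinv.fun_comp (A : M₂) (contDiff_entry 1 1).contDiffAt)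
  refine (hquot.contMDiffAt.comp A (contMDiff_coe_Sp11 A)).congr_of_eventuallyEq
    (Filter.Eventually.of_forall fun B => ?_)
  simp only [Function.comp_apply, coe_toBall, Ring.inverse_eq_inv']

/-! ### Boosts -/

/-- The Hermitian matrix with rows `(0, t̄)` and `(t, 0)`, as a real-linear function of `t`. -/
def offDiag : ℍ[ℝ] →ₗ[ℝ] M₂ where
  toFun t := !![0, star t; t, 0]
  map_add' s t := Matrix.ext fun i j => by fin_cases i <;> fin_cases j <;> simp
  map_smul' r t := Matrix.ext fun i j => by fin_cases i <;> fin_cases j <;> simp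

lemma offDiag_apply (t : ℍ[ℝ]) : offDiag t = !![0, star t; t, 0] := rfl

lemma conjTranspose_offDiag (t : ℍ[ℝ]) : (offDiag t)ᴴ = offDiag t :=
  Matrix.ext fun i j => by fin_cases i <;> fin_cases j <;> simp [offDiag_apply]

lemma offDiag_mul_J (t : ℍ[ℝ]) : offDiag t * J = -(J * offDiag t) :=
  Matrix.ext fun i j => by
    fin_cases i <;> fin_cases j <;> simp [offDiag_apply, J, Matrix.mul_apply]

lemma offDiag_mul_offDiag (t : ℍ[ℝ]) : offDiag t * offDiag t = ‖t‖ ^ 2 • (1 : M₂) := by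
  have h : ((‖t‖ ^ 2 : ℝ) : ℍ[ℝ]) = ‖t‖ ^ 2 • 1 := by
    rw [← Quaternion.coe_mul_eq_smul, mul_one]
  exact Matrix.ext fun i j => by
    fin_cases i <;> fin_cases j <;>
      simp [offDiag_apply, Matrix.mul_apply, Quaternion.star_mul_self, Quaternion.self_mul_star,
        Quaternion.normSq_eq_norm_mul_self, ← sq, ← h]

lemma conjTranspose_one_add_offDiag_mul_J_mul (t : ℍ[ℝ]) :
    (1 + offDiag t)ᴴ * J * (1 + offDiag t) = (1 - ‖t‖ ^ 2) • J := by
  calc (1 + offDiag t)ᴴ * J * (1 + offDiag t)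
      = J * (1 - offDiag t * offDiag t) := by
        rw [Matrix.conjTranspose_add, Matrix.conjTranspose_one, conjTranspose_offDiag,
          add_mul, one_mul, offDiag_mul_J]
        noncomm_ring
    _ = (1 - ‖t‖ ^ 2) • J := by
        rw [offDiag_mul_offDiag, mul_sub, mul_one, mul_smul_comm, mul_one, sub_smul, one_smul]

/-- The multiple of `1 + offDiag t` that preserves `J` when `t` lies in the unit ball: a
representative in `Sp(1,1)` of the double coset with coordinate `t`. -/
def boost (t : ℍ[ℝ]) : M₂ := (√(1 - ‖t‖ ^ 2))⁻¹ • (1 + offDiag t)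

lemma one_sub_norm_sq_pos {t : ℍ[ℝ]} (ht : t ∈ ball) : 0 < 1 - ‖t‖ ^ 2 :=
  sub_pos.2 (pow_lt_one₀ (norm_nonneg t) (mem_ball_iff.1 ht) two_ne_zero)

lemma boost_mem_Sp11 {t : ℍ[ℝ]} (ht : t ∈ ball) : boost t ∈ Sp11 := by
  have hpos := one_sub_norm_sq_pos ht
  have hsmul (r : ℝ) (X : M₂) : (r • X)ᴴ = r • Xᴴ :=
    Matrix.ext fun i j => by simp
  rw [mem_Sp11, boost, hsmul, smul_mul_assoc, smul_mul_assoc, mul_smul_comm,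
    conjTranspose_one_add_offDiag_mul_J_mul, smul_smul, smul_smul, ← mul_inv,
    Real.mul_self_sqrt hpos.le, inv_mul_cancel₀ hpos.ne', one_smul]

lemma contDiffAt_boost {t : ℍ[ℝ]} (ht : t ∈ ball) : ContDiffAt ℝ ∞ boost t := by
  have hpos := one_sub_norm_sq_pos ht
  have hnorm : ContDiffAt ℝ ∞ (fun q : ℍ[ℝ] => 1 - ‖q‖ ^ 2) t :=
    contDiffAt_const.sub (contDiff_norm_sq ℝ).contDiffAt
  exact ((hnorm.sqrt hpos.ne').inv (Real.sqrt_pos.2 hpos).ne').smul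
    (contDiffAt_const.add offDiag.toContinuousLinearMap.contDiff.contDiffAt)

/-- The boosts as a map from the unit ball to `Sp(1,1)`; it is a smooth section of `toBall`. -/
def boostSection (t : ball) : Sp11 := ⟨boost t, boost_mem_Sp11 t.2⟩

lemma contMDiff_boostSection : ContMDiff 𝓘(ℝ, ℍ[ℝ]) 𝓘(ℝ, sp11) ∞ boostSection :=
  contMDiff_Sp11_iff.2 fun t =>
    (contDiffAt_boost t.2).contMDiffAt.comp t (contMDiff_subtype_val t)

lemma toBall_boostSection (t : ball) : toBall (boostSection t) = t := by
  have hr : (√(1 - ‖(t : ℍ[ℝ])‖ ^ 2))⁻¹ ≠ 0 :=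
    (inv_pos.2 (Real.sqrt_pos.2 (one_sub_norm_sq_pos t.2))).ne'
  rw [Subtype.ext_iff, coe_toBall]
  simp only [boostSection, boost, offDiag_apply, Matrix.smul_apply, Matrix.add_apply,
    Matrix.one_apply_eq, Matrix.one_apply_ne one_ne_zero, Matrix.of_apply, Matrix.cons_val_zero,
    Matrix.cons_val_one, zero_add, add_zero, smul_inv₀, inv_one]
  rw [smul_mul_smul_comm, mul_one, mul_inv_cancel₀ hr, one_smul]

/-! ### The manifold structure of the double coset space -/

lemma proj_mul_mul {A B X : Sp11} (hA : A ∈ leftSubgroup) (hB : B ∈ rightSubgroup) :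
    proj (A * X * B) = proj X :=
  ((DoubleCoset.eq _ _ _ _).2 ⟨A, hA, B, hB, rfl⟩).symm

lemma proj_surjective : Function.Surjective proj := Quotient.mk_surjective

/-- The homeomorphism from the double coset space to the unit ball induced by `toBall`. -/
def dcosetHomeomorph : DCoset ≃ₜ ball where
  toFun := Quotient.lift toBall fun _ _ h => proj_eq_proj_iff.1 (Quotient.sound h)
  invFun t := proj (boostSection t)
  left_inv := proj_surjective.forall.2 fun A => proj_eq_proj_iff.2 (toBall_boostSection (toBall A))
  right_inv := toBall_boostSection
  continuous_toFun := continuous_coinduced_dom.2 contMDiff_toBall.continuous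
  continuous_invFun := continuous_coinduced_rng.comp contMDiff_boostSection.continuous

lemma proj_boostSection (x : DCoset) : proj (boostSection (dcosetHomeomorph x)) = x :=
  dcosetHomeomorph.symm_apply_apply x

/-- The global coordinates of the double coset space: those of the unit ball of `ℍ ≅ ℝ⁴`. -/
def dcosetCoord (x : DCoset) : EuclideanSpace ℝ (Fin 4) :=
  Quaternion.linearIsometryEquivTuple (dcosetHomeomorph x : ℍ[ℝ])

lemma isOpenEmbedding_dcosetCoord : Topology.IsOpenEmbedding dcosetCoord :=
  Quaternion.linearIsometryEquivTuple.toHomeomorph.isOpenEmbedding.comp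
    (ball.isOpen.isOpenEmbedding_subtypeVal.comp dcosetHomeomorph.isOpenEmbedding)

/-- The manifold structure of the double coset space whose only chart is `dcosetCoord`. -/
@[reducible] def dcosetChartedSpace : ChartedSpace (EuclideanSpace ℝ (Fin 4)) DCoset :=
  isOpenEmbedding_dcosetCoord.singletonChartedSpace

section

attribute [local instance] dcosetChartedSpace

lemma contMDiff_dcosetHomeomorph : ContMDiff (𝓡 4) 𝓘(ℝ, ℍ[ℝ]) ∞ dcosetHomeomorph := by
  rw [← ContMDiff.subtypeVal_comp_iff]
  have hcoord : ContMDiff (𝓡 4) (𝓡 4) ∞ dcosetCoord :=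
    contMDiff_isOpenEmbedding isOpenEmbedding_dcosetCoord
  have hequiv := (Quaternion.linearIsometryEquivTuple.symm.contDiff (n := ∞)).contMDiff
  exact (hequiv.comp hcoord).congr fun x => (LinearIsometryEquiv.symm_apply_apply _ _).symm

lemma contMDiff_dcosetHomeomorph_symm : ContMDiff 𝓘(ℝ, ℍ[ℝ]) (𝓡 4) ∞ dcosetHomeomorph.symm := by
  have hcoord (t : ball) : Quaternion.linearIsometryEquivTuple (t : ℍ[ℝ])
      = dcosetCoord (dcosetHomeomorph.symm t) := by
    rw [dcosetCoord, Homeomorph.apply_symm_apply]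
  have hequiv : ContMDiff 𝓘(ℝ, ℍ[ℝ]) (𝓡 4) ∞
      (fun t : ball => Quaternion.linearIsometryEquivTuple (t : ℍ[ℝ])) :=
    (Quaternion.linearIsometryEquivTuple.contDiff (n := ∞)).contMDiff.comp contMDiff_subtype_val
  have hsymm := (contMDiffOn_isOpenEmbedding_symm isOpenEmbedding_dcosetCoord (I := 𝓡 4)
    (n := ∞)).comp_contMDiff hequiv fun t => ⟨_, (hcoord t).symm⟩
  refine hsymm.congr fun t => ?_
  rw [Function.comp_apply, hcoord]
  exact (isOpenEmbedding_dcosetCoord.toOpenPartialHomeomorph_left_inv dcosetCoord).symm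

lemma contMDiff_proj : ContMDiff 𝓘(ℝ, sp11) (𝓡 4) ∞ proj :=
  (contMDiff_dcosetHomeomorph_symm.comp contMDiff_toBall).congr fun A =>
    (dcosetHomeomorph.symm_apply_apply (proj A)).symm

lemma mfderiv_proj_surjective (A : Sp11) :
    Function.Surjective (mfderiv 𝓘(ℝ, sp11) (𝓡 4) proj A) := by
  obtain ⟨x, hx, y, hy, hA⟩ := (DoubleCoset.eq _ _ _ _).1 (proj_boostSection (proj A))
  let s : DCoset → Sp11 := fun c => x * boostSection (dcosetHomeomorph c) * y
  have hs : ContMDiff (𝓡 4) 𝓘(ℝ, sp11) ∞ s :=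
    (contMDiff_mul_mul x y).comp (contMDiff_boostSection.comp contMDiff_dcosetHomeomorph)
  refine mfderiv_surjective_of_eventually_rightInverse (s := s) hA.symm
    (contMDiff_proj.mdifferentiableAt (by simp)) (hs.mdifferentiableAt (by simp))
    (Filter.Eventually.of_forall fun c => ?_)
  rw [proj_mul_mul hx hy, proj_boostSection]

/-- `dcosetHomeomorph` as a diffeomorphism. -/
def dcosetDiffeomorph : DCoset ≃ₘ^∞⟮𝓡 4, 𝓘(ℝ, ℍ[ℝ])⟯ ball where
  toEquiv := dcosetHomeomorph.toEquiv
  contMDiff_toFun := contMDiff_dcosetHomeomorph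
  contMDiff_invFun := contMDiff_dcosetHomeomorph_symm

end

lemma isNaturalStructure_dcosetChartedSpace : IsNaturalStructure dcosetChartedSpace where
  isManifold := isOpenEmbedding_dcosetCoord.isManifold_singleton
  isSubmersion :=
    letI := dcosetChartedSpace
    { contMDiff := contMDiff_proj
      surjective := proj_surjective
      mfderiv_surjective := mfderiv_proj_surjective }

lemma IsNaturalStructure.contMDiff_id {m n : ℕ}
    {cs : ChartedSpace (EuclideanSpace ℝ (Fin m)) DCoset}
    {cs' : ChartedSpace (EuclideanSpace ℝ (Fin n)) DCoset}
    (h : IsNaturalStructure cs) (h' : IsNaturalStructure cs') :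
    @ContMDiff ℝ _ _ _ _ _ _ (𝓡 m) DCoset _ cs _ _ _ _ _ (𝓡 n) DCoset _ cs' ∞ id :=
  IsSubmersion.contMDiff_of_comp h.isSubmersion h'.isSubmersion.contMDiff

end RegMobius

end

theorem mainTheorem5 :
    -- each `𝓕_A` is a bijection of the unit ball onto itself
    (∀ A : Sp11, Set.BijOn (regMobius A) RegMobius.ball RegMobius.ball) ∧
    -- the double coset space is Hausdorff and second countable, and has a natural manifold
    -- structure `cs`, of dimension four,
    T2Space DCoset ∧ SecondCountableTopology DCoset ∧
    ∃ cs : ChartedSpace (EuclideanSpace ℝ (Fin 4)) DCoset,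
      IsNaturalStructure cs ∧
      -- which is unique (the identity map to any other one is a diffeomorphism),
      (∀ (n : ℕ) (cs' : ChartedSpace (EuclideanSpace ℝ (Fin n)) DCoset), IsNaturalStructure cs' →
        @ContMDiff ℝ _ _ _ _ _ _ (𝓡 4) DCoset _ cs _ _ _ _ _ (𝓡 n) DCoset _ cs' ∞ id ∧
        @ContMDiff ℝ _ _ _ _ _ _ (𝓡 n) DCoset _ cs' _ _ _ _ _ (𝓡 4) DCoset _ cs ∞ id) ∧
      -- and the double coset of `A ↦ (𝓕_{A⁻¹})⁻¹(0)` is a well-defined diffeomorphism.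
      ∃ Φ : DCoset ≃ₘ^∞⟮𝓡 4, 𝓘(ℝ, ℍ[ℝ])⟯ RegMobius.ball,
        ∀ A : Sp11, {q : ℍ[ℝ] | q ∈ RegMobius.ball ∧ regMobius A⁻¹ q = 0} = {(Φ (proj A) : ℍ[ℝ])} := by
  have hcs := isNaturalStructure_dcosetChartedSpace
  refine ⟨regMobius_bijOn, dcosetHomeomorph.isEmbedding.t2Space,
    dcosetHomeomorph.isEmbedding.secondCountableTopology, dcosetChartedSpace, hcs,
    fun n cs' hcs' => ⟨hcs.contMDiff_id hcs', hcs'.contMDiff_id hcs⟩, dcosetDiffeomorph,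
    fun A => ?_⟩
  have hzero : (dcosetDiffeomorph (proj A) : ℍ[ℝ]) = fracLin A 0 := rfl
  rw [hzero]
  exact Set.ext fun q => regMobius_inv_eq_iff A zero_mem_ball
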